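/- Let $X\subset\mathbb R^d$ be compact, and let $f\colon X\to X$ be piecewise affine: there is a finite collection $\mathcal Z$ of pairwise disjoint open polytopes (not necessarily convex) contained in $X$, whose union $X'$ is dense in $X$, such that $f|_Z$ is affine for every $Z\in\mathcal Z$ (the values of $f$ on $X\setminus X'$ play no role). For $n\ge 1$ let $U_n=\bigcap_{k=0}^{n-1}f^{-k}(X')$ be the set of points whose first $n$ iterates are well defined; for $x\in X'$ let $d_xf$ be the linear part of $f|_Z$, where $x\in Z\in\mathcal Z$, and for $x\in U_n$ let $d_xf^n=d_{f^{n-1}x}f\circ\cdots\circ d_xf$. Let $\mathcal Z^n$ be the continuity partition of $f^n$, that is, the collection of non-empty sets $Z_0\cap f^{-1}(Z_1)\cap\dots\cap f^{-(n-1)}(Z_{n-1})$ with $Z_0,\dots,Z_{n-1}\in\mathcal Z$. Let $\rho$ be any metric on $X$ that induces its standard topology, let $d_n^f(x,y)=\max_{0\le k<n}\rho(f^kx,f^ky)$, let $S(d_n^f,\varepsilon)$ be the minimal number of $(d_n^f,\varepsilon)$-balls (centred at points of $U_n$) needed to cover $U_n$, and put $$h(f)=\lim_{\varepsilon\to0}\limsup_{n\to\infty}\frac1n\log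 S(d_n^f,\varepsilon).$$ Put further $$\lambda^+(f)=\limsup_{n\to\infty}\sup_{x\in U_n}\frac1n\max_{0\le k\le d}\log\|\Lambda^k d_xf^n\|,\qquad H_{\mathrm{mult}}(f)=\limsup_{n\to\infty}\frac1n\log\,\sup_{a\in X}\bigl|\{Z\in\mathcal Z^n : a\in\overline Z\}\bigr|,$$ where $\Lambda^k A$ is the $k$-th exterior power of $A$ and $\|\cdot\|$ is the operator norm for the Euclidean norm on $\Lambda^k\mathbb R^d$ (with $\log 0=-\infty$ and $\sup\emptyset=-\infty$). Then $$h(f)\le\lambda^+(f)+H_{\mathrm{mult}}(f).$$ -/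

import Mathlib

open Set Filter Topology
open scoped ENNReal

/-- The Euclidean space `ℝ^d`. -/
abbrev Euc (d : ℕ) : Type := EuclideanSpace ℝ (Fin d)

/-- An open polytope, not necessarily convex: the interior of a finite union of convex hulls of
finite sets of points. The interior of a single convex hull is an open convex polytope. -/
def IsOpenPolytope {d : ℕ} (Z : Set (Euc d)) : Prop :=
  ∃ V : Finset (Finset (Euc d)), Z = interior (⋃ s ∈ V, convexHull ℝ (s : Set (Euc d)))

/-- A piecewise affine map `(X, 𝒵, f)` of a set `X ⊆ ℝ^d`. Only the values of `f` on
`X' = ⋃ 𝒵` are constrained; the notions below use no other value. -/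
structure PiecewiseAffineMap {d : ℕ} (X : Set (Euc d)) where
  /-- The map `f`. -/
  toFun : X → X
  /-- The collection `𝒵`. -/
  pieces : Set (Set (Euc d))
  finite_pieces : pieces.Finite
  isOpenPolytope : ∀ Z ∈ pieces, IsOpenPolytope Z
  pairwiseDisjoint : pieces.PairwiseDisjoint id
  subset : ∀ Z ∈ pieces, Z ⊆ X
  dense : X ⊆ closure (⋃₀ pieces)
  /-- The affine map of `ℝ^d` that `f` coincides with on a piece. -/
  component : Set (Euc d) → (Euc d →ᵃ[ℝ] Euc d)
  toFun_eq : ∀ Z ∈ pieces, ∀ x : X, (x : Euc d) ∈ Z → (toFun x : Euc d) = component Z x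

namespace PiecewiseAffineMap

variable {d : ℕ} {X : Set (Euc d)}

/-- `U_n = ⋂_{k < n} f^{-k}(X')`, where `X'` is the union of the pieces. -/
def domainIter (f : PiecewiseAffineMap X) (n : ℕ) : Set X :=
  {x | ∀ k < n, (f.toFun^[k] x : Euc d) ∈ ⋃₀ f.pieces}

open Classical in
/-- `d_x f`: the linear part of the affine component of `f` on the piece that contains `x`. -/
noncomputable def linearPart (f : PiecewiseAffineMap X) (x : X) : Euc d →ₗ[ℝ] Euc d :=
  if h : ∃ Z ∈ f.pieces, (x : Euc d) ∈ Z then (f.component h.choose).linear else 0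

/-- `d_x f^n = d_{f^{n-1} x} f ∘ ⋯ ∘ d_{f x} f ∘ d_x f`, meant for `x ∈ U_n`. -/
noncomputable def linearPartIter (f : PiecewiseAffineMap X) : ℕ → X → (Euc d →ₗ[ℝ] Euc d)
  | 0, _ => LinearMap.id
  | n + 1, x => f.linearPart (f.toFun^[n] x) ∘ₗ f.linearPartIter n x

/-- The metric `d_n^f(x, y) = max_{0 ≤ k < n} ρ(f^k x, f^k y)`. -/
noncomputable def dynDist (f : PiecewiseAffineMap X) (ρ : MetricSpace X) (n : ℕ) (x y : X) : ℝ :=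
  ⨆ k : Fin n, ρ.dist (f.toFun^[k] x) (f.toFun^[k] y)

/-- `S(d_n^f, ε)`: the minimal number of `(d_n^f, ε)`-balls, centred at points of `U_n`, that are
needed to cover `U_n`. -/
noncomputable def coverNumber (f : PiecewiseAffineMap X) (ρ : MetricSpace X) (ε : ℝ) (n : ℕ) :
    ℕ∞ :=
  ⨅ (C : Set X) (_ : C ⊆ f.domainIter n)
    (_ : ∀ x ∈ f.domainIter n, ∃ c ∈ C, f.dynDist ρ n c x < ε), C.encard

/-- `limsup_n (1/n) log S(d_n^f, ε)`. -/
noncomputable def entropyAt (f : PiecewiseAffineMap X) (ρ : MetricSpace X) (ε : ℝ) : EReal :=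
  limsup (fun n : ℕ => ENNReal.log (f.coverNumber ρ ε n : ℝ≥0∞) / (n : EReal)) atTop

/-- The entropy `h(f)`, the limit of `entropyAt` as `ε → 0+`; by monotonicity it is a supremum. -/
noncomputable def entropy (f : PiecewiseAffineMap X) (ρ : MetricSpace X) : EReal :=
  ⨆ (ε : ℝ) (_ : 0 < ε), f.entropyAt ρ ε

theorem entropyAt_antitone (f : PiecewiseAffineMap X) (ρ : MetricSpace X) :
    Antitone (f.entropyAt ρ) := by
  intro ε δ h
  refine limsup_le_limsup (Eventually.of_forall fun n => ?_)
  refine EReal.div_le_div_right_of_nonneg (by positivity) (ENNReal.log_monotone ?_)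
  refine ENat.toENNReal_le.2 ?_
  refine le_iInf fun C => le_iInf fun hC => le_iInf fun hcov => ?_
  refine iInf_le_of_le C (iInf_le_of_le hC (iInf_le_of_le (fun x hx => ?_) le_rfl))
  obtain ⟨c, hc, hlt⟩ := hcov x hx
  exact ⟨c, hc, hlt.trans_le h⟩

theorem tendsto_entropyAt (f : PiecewiseAffineMap X) (ρ : MetricSpace X) :
    Tendsto (f.entropyAt ρ) (𝓝[>] 0) (𝓝 (f.entropy ρ)) := by
  have h := (f.entropyAt_antitone ρ).tendsto_nhdsGT 0
  rwa [sSup_image] at h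

/-- The continuity partition `𝒵^n` of `f^n`: the non-empty sets
`Z_0 ∩ f^{-1}(Z_1) ∩ ⋯ ∩ f^{-(n-1)}(Z_{n-1})` with all `Z_k ∈ 𝒵`. -/
def partitionIter (f : PiecewiseAffineMap X) (n : ℕ) : Set (Set X) :=
  {A | A.Nonempty ∧ ∃ w : Fin n → Set (Euc d), (∀ k, w k ∈ f.pieces) ∧
    A = {x : X | ∀ k : Fin n, (f.toFun^[k] x : Euc d) ∈ w k}}

/-- `mult(𝒵^n) = sup_{a ∈ X} |{Z ∈ 𝒵^n | a ∈ closure Z}|`. -/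
noncomputable def mult (f : PiecewiseAffineMap X) (n : ℕ) : ℕ∞ :=
  ⨆ a : X, {A ∈ f.partitionIter n | a ∈ closure A}.encard

/-- The multiplicity entropy `H_mult(f) = limsup_n (1/n) log mult(𝒵^n)`. -/
noncomputable def multEntropy (f : PiecewiseAffineMap X) : EReal :=
  limsup (fun n : ℕ => ENNReal.log (f.mult n : ℝ≥0∞) / (n : EReal)) atTop

/-- `‖Λ^k A‖`: the operator norm of the `k`-th exterior power of `A` for the Euclidean norm of
`Λ^k ℝ^d`. -/
noncomputable def extPowerNorm (k : ℕ) (A : Euc d →ₗ[ℝ] Euc d) : ℝ :=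
  ‖(exteriorPower.map k A).toContinuousLinearMap‖

/-- `λ^+(f) = limsup_n sup_{x ∈ U_n} (1/n) max_{0 ≤ k ≤ d} log ‖Λ^k d_x f^n‖`. -/
noncomputable def expansionRate (f : PiecewiseAffineMap X) : EReal :=
  limsup (fun n : ℕ => ⨆ x ∈ f.domainIter n,
    (⨆ k : Fin (d + 1),
      ENNReal.log (ENNReal.ofReal (extPowerNorm k (f.linearPartIter n x)))) / (n : EReal)) atTop

end PiecewiseAffineMap

/-! Fix a block length `T`. If `r` is small, a set of diameter at most `r` meets at most `mult T`
elements of the partition for `f^T` (`exists_pos_encard_le_mult`). On each of them `f^T` is affine,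
and an affine image of a set of diameter at most `r` splits into at most a dimensional constant
times `max_k ‖Λ^k A‖` sets of diameter at most `r` (`splits_of_dist_le`): only the expanding
singular directions of `A` need cutting, and `max_k ‖Λ^k A‖` dominates the product of their singular
values.

The resulting sets are again of diameter at most `r`, so blocks can be chained (`splits_blocks`),
and the cover numbers grow at most like the `n / T`-th power of the one-block count. The dimensional
constant contributes `O(1 / T)` to the growth rate and disappears as `T → ∞`. -/

/-! ### Colourings as a substitute for covers. -/

/-- The set `S` can be coloured with `N` colours so that points of the same colour are related. -/
def Splits {α : Type*} (S : Set α) (N : ℕ) (R : α → α → Prop) : Prop :=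
  ∃ c : α → ℕ, (∀ x ∈ S, c x < N) ∧ ∀ x ∈ S, ∀ y ∈ S, c x = c y → R x y

namespace Splits

variable {α β κ : Type*} {S P : Set α} {N K : ℕ} {R R' : α → α → Prop}

theorem of_finset (t : Finset κ) (c : α → κ) (hc : ∀ x ∈ S, c x ∈ t)
    (hR : ∀ x ∈ S, ∀ y ∈ S, c x = c y → R x y) : Splits S t.card R := by
  classical
  refine ⟨fun x => if h : c x ∈ t then t.equivFin ⟨c x, h⟩ else 0, fun x hx => ?_,
    fun x hx y hy h => hR x hx y hy ?_⟩
  · simp [hc x hx]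
  · simpa [hc x hx, hc y hy, Fin.val_inj] using h

theorem mono_card (h : Splits S N R) (hNK : N ≤ K) : Splits S K R := by
  obtain ⟨c, hc, hR⟩ := h
  exact ⟨c, fun x hx => (hc x hx).trans_le hNK, hR⟩

theorem mono (h : Splits S N R) (hP : P ⊆ S) (hR : ∀ x ∈ P, ∀ y ∈ P, R x y → R' x y) :
    Splits P N R' := by
  obtain ⟨c, hc, hcR⟩ := h
  exact ⟨c, fun x hx => hc x (hP hx), fun x hx y hy hxy =>
    hR x hx y hy (hcR x (hP hx) y (hP hy) hxy)⟩

theorem of_image {R : β → β → Prop} (g : α → β) (h : Splits (g '' S) N R) :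
    Splits S N fun x y => R (g x) (g y) := by
  obtain ⟨c, hc, hR⟩ := h
  exact ⟨c ∘ g, fun x hx => hc _ (mem_image_of_mem g hx), fun x hx y hy hxy =>
    hR _ (mem_image_of_mem g hx) _ (mem_image_of_mem g hy) hxy⟩

/-- Pairs of colours: each class of the first colouring gets its own second colouring, and the bound
`K` is uniform over the classes. -/
theorem refine (h : Splits S N R)
    (hK : ∀ P ⊆ S, (∀ x ∈ P, ∀ y ∈ P, R x y) → Splits P K R') :
    Splits S (N * K) fun x y => R x y ∧ R' x y := by
  obtain ⟨c, hc, hR⟩ := h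
  have key : ∀ j, Splits {x ∈ S | c x = j} K R' := fun j =>
    hK _ (sep_subset _ _) fun x hx y hy => hR x hx.1 y hy.1 (hx.2.trans hy.2.symm)
  choose c' hc' hR' using key
  have := of_finset (S := S) (R := fun x y => R x y ∧ R' x y)
    (Finset.range N ×ˢ Finset.range K) (fun x => (c x, c' (c x) x))
    (fun x hx => by simpa using ⟨hc x hx, hc' _ x ⟨hx, rfl⟩⟩)
    (fun x hx y hy hxy => by
      obtain ⟨h1, h2⟩ := Prod.mk.inj hxy
      refine ⟨hR x hx y hy h1, hR' (c x) x ⟨hx, rfl⟩ y ⟨hy, h1.symm⟩ ?_⟩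
      rw [h2, h1])
  simpa using this

/-- One representative per colour in use. The centres stay inside `S`, as `coverNumber` demands. -/
theorem exists_centres (h : Splits S N R) :
    ∃ C ⊆ S, C.encard ≤ N ∧ ∀ x ∈ S, ∃ y ∈ C, R y x := by
  obtain ⟨c, hc, hR⟩ := h
  obtain ⟨C, hCS, hC⟩ := (Set.surjOn_image c S).exists_bijOn_subset
  refine ⟨C, hCS, ?_, fun x hx => ?_⟩
  · rw [← hC.injOn.encard_image, hC.image_eq]
    refine (encard_le_encard (t := ↑(Finset.range N)) ?_).trans
      ((encard_coe_eq_coe_finsetCard _).trans_le (by simp))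
    rintro _ ⟨x, hx, rfl⟩
    simpa using hc x hx
  · obtain ⟨y, hy, hyx⟩ := hC.surjOn (mem_image_of_mem c hx)
    exact ⟨y, hy, hR y (hCS hy) x hx hyx⟩

end Splits

/-! ### Linear algebra: cutting a linear image by singular values. -/

open scoped RealInnerProductSpace in
/-- The singular value decomposition of `A`, in the form of an orthonormal basis whose image is
an orthogonal family. -/
theorem exists_orthonormalBasis_orthogonal_image {d : ℕ} (A : Euc d →ₗ[ℝ] Euc d) :
    ∃ b : OrthonormalBasis (Fin d) ℝ (Euc d), Pairwise fun i j => ⟪A (b i), A (b j)⟫ = 0 := by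
  have hT := A.isPositive_adjoint_comp_self.isSymmetric
  have hd : Module.finrank ℝ (Euc d) = d := by simp
  refine ⟨hT.eigenvectorBasis hd, fun i j hij => ?_⟩
  beta_reduce
  rw [← LinearMap.adjoint_inner_left, ← LinearMap.comp_apply, hT.apply_eigenvectorBasis hd,
    inner_smul_left, (hT.eigenvectorBasis hd).inner_eq_zero hij, mul_zero]

namespace PiecewiseAffineMap

variable {d : ℕ}

-- Apply `Λ^k A` to the wedge of the `k` basis vectors with `1 < ‖A (b i)‖`. Its Gram matrix is the
-- identity, so it is a unit vector; the Gram matrix of the image is diagonal, so the image has norm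
-- the product of these `‖A (b i)‖`. All other factors of the product are `1`.
open scoped RealInnerProductSpace in
theorem exists_prod_max_le_extPowerNorm (A : Euc d →ₗ[ℝ] Euc d)
    (b : OrthonormalBasis (Fin d) ℝ (Euc d))
    (hb : Pairwise fun i j => ⟪A (b i), A (b j)⟫ = 0) :
    ∃ k : Fin (d + 1), ∏ i, max 1 ‖A (b i)‖ ≤ extPowerNorm k A := by
  classical
  set S : Finset (Fin d) := Finset.univ.filter fun i => 1 < ‖A (b i)‖ with hS
  have hk : S.card < d + 1 := by
    have := S.card_le_univ
    simp at this
    omega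
  set e := S.orderEmbOfFin rfl with he
  refine ⟨⟨S.card, hk⟩, ?_⟩
  have h1 : ‖exteriorPower.ιMulti ℝ S.card (b ∘ e)‖ = 1 := by
    have : Matrix.gram ℝ (b ∘ e) = 1 :=
      Matrix.gram_eq_one_iff_orthonormal.2 (b.orthonormal.comp e e.injective)
    rw [← sq_eq_sq₀ (norm_nonneg _) zero_le_one, ← real_inner_self_eq_norm_sq,
      exteriorPower.inner_ιMulti_self, this, Matrix.det_one, one_pow]
  have h2 : ‖exteriorPower.ιMulti ℝ S.card (A ∘ b ∘ e)‖ = ∏ i, max 1 ‖A (b i)‖ := by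
    have hprod : ∏ i, max 1 ‖A (b i)‖ = ∏ i : Fin S.card, ‖A (b (e i))‖ := by
      rw [← Finset.prod_subset S.subset_univ, ← Finset.prod_coe_sort S,
        ← (S.orderIsoOfFin rfl).toEquiv.prod_comp]
      · refine Finset.prod_congr rfl fun i _ => ?_
        have : 1 < ‖A (b (e i))‖ := (Finset.mem_filter.1 (S.orderEmbOfFin_mem rfl i)).2
        exact max_eq_right this.le
      · intro i _ hi
        exact max_eq_left (by simpa [hS] using hi)
    have : Matrix.gram ℝ (A ∘ b ∘ e) = Matrix.diagonal fun i => ‖A (b (e i))‖ ^ 2 := by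
      ext i j
      rcases eq_or_ne i j with rfl | hij
      · simp [Matrix.gram_apply]
      · simpa [Matrix.gram_apply, hij] using hb (e.injective.ne hij)
    rw [hprod, ← sq_eq_sq₀ (norm_nonneg _) (by positivity), ← real_inner_self_eq_norm_sq,
      exteriorPower.inner_ιMulti_self, this, Matrix.det_diagonal, Finset.prod_pow]
  have := (exteriorPower.map S.card A).toContinuousLinearMap.le_opNorm
    (exteriorPower.ιMulti ℝ S.card (b ∘ e))
  rw [LinearMap.coe_toContinuousLinearMap', exteriorPower.map_apply_ιMulti, h1, h2, mul_one] at this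
  exact this

-- Cut `P` along `b` into boxes of sides `r / m i` with `m i ≥ d * ‖A (b i)‖`. Each of the `d`
-- directions then adds at most `r / d` to `‖A (x - y)‖`.
open scoped RealInnerProductSpace in
theorem splits_of_dist_le (A : Euc d →ₗ[ℝ] Euc d) {r L : ℝ} (hr : 0 < r)
    (hL : ∀ k : Fin (d + 1), extPowerNorm k A ≤ L) {P : Set (Euc d)}
    (hP : ∀ x ∈ P, ∀ y ∈ P, dist x y ≤ r) :
    Splits P ⌊(2 * d + 5 : ℝ) ^ d * L⌋₊ fun x y => ‖A (x - y)‖ ≤ r := by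
  classical
  obtain ⟨b, hb⟩ := exists_orthonormalBasis_orthogonal_image A
  obtain ⟨k, hk⟩ := exists_prod_max_le_extPowerNorm A b hb
  rcases P.eq_empty_or_nonempty with rfl | ⟨p, hp⟩
  · exact ⟨fun _ => 0, by simp, by simp⟩
  -- The `+ 1` keeps `m i` positive when `A (b i) = 0`. Since `m i ≤ d * ‖A (b i)‖ + 2`, the count
  -- `2 * m i + 1` is at most `(2 * d + 5) * max 1 ‖A (b i)‖`.
  set m : Fin d → ℕ := fun i => ⌈d * ‖A (b i)‖⌉₊ + 1 with hm
  have hm0 : ∀ i, (0 : ℝ) < m i := fun i => by positivity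
  have hmA : ∀ i, d * ‖A (b i)‖ ≤ m i := fun i => by
    have := Nat.le_ceil (d * ‖A (b i)‖)
    simp only [hm]
    push_cast
    linarith
  have hcoord : ∀ x ∈ P, ∀ y ∈ P, ∀ i, |⟪b i, x - y⟫| ≤ r := fun x hx y hy i => by
    refine (abs_real_inner_le_norm _ _).trans ?_
    rw [b.norm_eq_one, one_mul, ← dist_eq_norm]
    exact hP x hx y hy
  have hcol := Splits.of_finset (S := P) (R := fun x y => ‖A (x - y)‖ ≤ r)
    (Fintype.piFinset fun i => Finset.Icc (-(m i : ℤ)) (m i))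
    (fun x i => ⌊⟪b i, x - p⟫ * m i / r⌋) ?_ ?_
  · refine hcol.mono_card (Nat.le_floor ?_)
    rw [Fintype.card_piFinset]
    push_cast
    calc ∏ i, ((Finset.Icc (-(m i : ℤ)) (m i)).card : ℝ)
        ≤ ∏ i : Fin d, (2 * d + 5 : ℝ) * max 1 ‖A (b i)‖ := by
          refine Finset.prod_le_prod (fun _ _ => by positivity) fun i _ => ?_
          have h1 := Nat.ceil_lt_add_one (show 0 ≤ d * ‖A (b i)‖ by positivity)
          have h2 : (m i : ℝ) ≤ d * ‖A (b i)‖ + 2 := by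
            simp only [hm]
            push_cast
            linarith
          have h3 : ((Finset.Icc (-(m i : ℤ)) (m i)).card : ℝ) = 2 * m i + 1 := by
            rw [Int.card_Icc, show ((m i : ℤ) + 1 - -(m i : ℤ)).toNat = 2 * m i + 1 by omega]
            push_cast
            ring
          rw [h3]
          nlinarith [le_max_left 1 ‖A (b i)‖, mul_le_mul_of_nonneg_left
            (le_max_right 1 ‖A (b i)‖) (Nat.cast_nonneg d)]
      _ = (2 * d + 5 : ℝ) ^ d * ∏ i, max 1 ‖A (b i)‖ := by simp [Finset.prod_mul_distrib]
      _ ≤ _ := by gcongr; exact hk.trans (hL k)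
  · intro x hx
    simp only [Fintype.mem_piFinset, Finset.mem_Icc]
    intro i
    have h := abs_le.1 (hcoord x hx p hp i)
    constructor
    · rw [Int.le_floor, le_div_iff₀ hr]
      push_cast
      nlinarith [hm0 i]
    · refine Int.floor_le_iff.2 ?_
      rw [div_lt_iff₀ hr]
      push_cast
      nlinarith [hm0 i]
  · intro x hx y hy hxy
    have hi : ∀ i, |⟪b i, x - y⟫| * m i ≤ r := fun i => by
      have h := Int.abs_sub_lt_one_of_floor_eq_floor (congrFun hxy i)
      have e : ⟪b i, x - p⟫ * m i / r - ⟪b i, y - p⟫ * m i / r = ⟪b i, x - y⟫ * m i / r := by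
        rw [← sub_div, ← sub_mul, ← inner_sub_right, sub_sub_sub_cancel_right]
      rw [e, abs_div, abs_of_pos hr, div_lt_one hr, abs_mul, abs_of_pos (hm0 i)] at h
      exact h.le
    conv_lhs => rw [← b.sum_repr' (x - y), map_sum]
    rcases Nat.eq_zero_or_pos d with rfl | hd
    · simpa using hr.le
    calc ‖∑ i, A (⟪b i, x - y⟫ • b i)‖ ≤ ∑ i, ‖A (⟪b i, x - y⟫ • b i)‖ := norm_sum_le _ _
      _ ≤ ∑ _i : Fin d, r / d := by
          refine Finset.sum_le_sum fun i _ => ?_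
          have hd' : (0 : ℝ) < d := by exact_mod_cast hd
          rw [map_smul, norm_smul, Real.norm_eq_abs, le_div_iff₀ hd']
          nlinarith [hi i, hmA i, abs_nonneg ⟪b i, x - y⟫]
      _ = r := by
          have hd' : (d : ℝ) ≠ 0 := by positivity
          simp
          field_simp

end PiecewiseAffineMap

/-! ### Itineraries, the partition of `f^n` and its multiplicity. -/

namespace PiecewiseAffineMap

variable {d : ℕ} {X : Set (Euc d)}

/-- The orbits of `x` and `y` visit the same pieces at all times `k < n`. -/
def SameItinerary (f : PiecewiseAffineMap X) (n : ℕ) (x y : X) : Prop :=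
  ∀ k < n, ∃ Z ∈ f.pieces, (f.toFun^[k] x : Euc d) ∈ Z ∧ (f.toFun^[k] y : Euc d) ∈ Z

theorem eq_of_mem_pieces (f : PiecewiseAffineMap X) {Z W : Set (Euc d)} (hZ : Z ∈ f.pieces)
    (hW : W ∈ f.pieces) {p : Euc d} (hpZ : p ∈ Z) (hpW : p ∈ W) : Z = W :=
  f.pairwiseDisjoint.elim_set hZ hW p hpZ hpW

theorem linearPart_eq (f : PiecewiseAffineMap X) {Z : Set (Euc d)} (hZ : Z ∈ f.pieces) {x : X}
    (hx : (x : Euc d) ∈ Z) : f.linearPart x = (f.component Z).linear := by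
  have h : ∃ Z ∈ f.pieces, (x : Euc d) ∈ Z := ⟨Z, hZ, hx⟩
  rw [linearPart, dif_pos h, f.eq_of_mem_pieces h.choose_spec.1 hZ h.choose_spec.2 hx]

theorem mem_domainIter_of_le (f : PiecewiseAffineMap X) {m n : ℕ} (h : m ≤ n) {x : X}
    (hx : x ∈ f.domainIter n) : x ∈ f.domainIter m := fun k hk => hx k (hk.trans_le h)

theorem iterate_mem_domainIter (f : PiecewiseAffineMap X) {m n : ℕ} {x : X}
    (hx : x ∈ f.domainIter (m + n)) : f.toFun^[m] x ∈ f.domainIter n := fun k hk => by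
  rw [← Function.iterate_add_apply]
  exact hx _ (by omega)

namespace SameItinerary

variable {f : PiecewiseAffineMap X} {m n : ℕ} {x y z : X}

theorem refl_of_mem (hx : x ∈ f.domainIter n) : f.SameItinerary n x x := fun k hk => by
  obtain ⟨Z, hZ, h⟩ := hx k hk
  exact ⟨Z, hZ, h, h⟩

theorem mono (h : f.SameItinerary n x y) (hmn : m ≤ n) : f.SameItinerary m x y :=
  fun k hk => h k (hk.trans_le hmn)

theorem linearPartIter_eq (h : f.SameItinerary n x y) :
    f.linearPartIter n x = f.linearPartIter n y := by
  induction n with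
  | zero => rfl
  | succ n ih =>
    obtain ⟨Z, hZ, hx, hy⟩ := h n n.lt_succ_self
    rw [linearPartIter, linearPartIter, ih (h.mono n.le_succ), f.linearPart_eq hZ hx,
      f.linearPart_eq hZ hy]

theorem iterate_sub (h : f.SameItinerary n x y) :
    (f.toFun^[n] x - f.toFun^[n] y : Euc d) = f.linearPartIter n x (x - y : Euc d) := by
  induction n with
  | zero => rfl
  | succ n ih =>
    obtain ⟨Z, hZ, hx, hy⟩ := h n n.lt_succ_self
    rw [linearPartIter, LinearMap.comp_apply, ← ih (h.mono n.le_succ), f.linearPart_eq hZ hx,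
      Function.iterate_succ_apply', Function.iterate_succ_apply', f.toFun_eq Z hZ _ hx,
      f.toFun_eq Z hZ _ hy]
    exact ((f.component Z).linearMap_vsub _ _).symm

theorem dist_le {L : ℝ} (hL : 1 ≤ L)
    (hLip : ∀ Z ∈ f.pieces, ∀ v, ‖(f.component Z).linear v‖ ≤ L * ‖v‖)
    (h : f.SameItinerary n x y) : dist (f.toFun^[n] x) (f.toFun^[n] y) ≤ L ^ n * dist x y := by
  induction n with
  | zero => simp
  | succ n ih =>
    obtain ⟨Z, hZ, hx, hy⟩ := h n n.lt_succ_self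
    rw [Function.iterate_succ_apply', Function.iterate_succ_apply', Subtype.dist_eq,
      f.toFun_eq Z hZ _ hx, f.toFun_eq Z hZ _ hy, dist_eq_norm, ← vsub_eq_sub,
      ← AffineMap.linearMap_vsub, pow_succ', mul_assoc]
    refine (hLip Z hZ _).trans ?_
    gcongr
    rw [vsub_eq_sub, ← dist_eq_norm]
    exact ih (h.mono n.le_succ)

theorem dist_le_of_le {L : ℝ} (hL : 1 ≤ L)
    (hLip : ∀ Z ∈ f.pieces, ∀ v, ‖(f.component Z).linear v‖ ≤ L * ‖v‖)
    (h : f.SameItinerary n x y) (hmn : m ≤ n) :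
    dist (f.toFun^[m] x) (f.toFun^[m] y) ≤ L ^ n * dist x y :=
  ((h.mono hmn).dist_le hL hLip).trans (by gcongr)

end SameItinerary

theorem exists_lipschitz (f : PiecewiseAffineMap X) :
    ∃ L : ℝ, 1 ≤ L ∧ ∀ Z ∈ f.pieces, ∀ v, ‖(f.component Z).linear v‖ ≤ L * ‖v‖ := by
  obtain ⟨M, hM⟩ := (f.finite_pieces.image fun Z =>
    ‖(f.component Z).linear.toContinuousLinearMap‖).bddAbove
  refine ⟨max 1 M, le_max_left _ _, fun Z hZ v => ?_⟩
  refine ((f.component Z).linear.toContinuousLinearMap.le_opNorm v).trans ?_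
  gcongr
  exact (hM (mem_image_of_mem _ hZ)).trans (le_max_right _ _)

/-- Pieces are disjoint, so the itinerary of `x` determines its partition element. -/
theorem setOf_sameItinerary_mem_partitionIter (f : PiecewiseAffineMap X) {n : ℕ} {x : X}
    (hx : x ∈ f.domainIter n) : {y | f.SameItinerary n x y} ∈ f.partitionIter n := by
  refine ⟨⟨x, .refl_of_mem hx⟩, ?_⟩
  choose w hw hxw using fun k : Fin n => hx k k.2
  refine ⟨w, hw, ?_⟩
  ext y
  refine ⟨fun h k => ?_, fun h k hk => ⟨w ⟨k, hk⟩, hw _, hxw ⟨k, hk⟩, h ⟨k, hk⟩⟩⟩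
  obtain ⟨Z, hZ, hxZ, hyZ⟩ := h k k.2
  rwa [f.eq_of_mem_pieces (hw k) hZ (hxw k) hxZ]

theorem finite_partitionIter (f : PiecewiseAffineMap X) (n : ℕ) : (f.partitionIter n).Finite := by
  refine ((Set.Finite.pi' fun _ : Fin n => f.finite_pieces).image fun w =>
    {x : X | ∀ k : Fin n, (f.toFun^[k] x : Euc d) ∈ w k}).subset ?_
  rintro _ ⟨-, w, hw, rfl⟩
  exact mem_image_of_mem _ hw

theorem mult_lt_top (f : PiecewiseAffineMap X) (n : ℕ) : f.mult n < ⊤ :=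
  (iSup_le fun _ => encard_le_encard (sep_subset _ _)).trans_lt
    (f.finite_partitionIter n).encard_lt_top

theorem finite_image_linearPartIter (f : PiecewiseAffineMap X) (n : ℕ) :
    (f.linearPartIter n '' f.domainIter n).Finite := by
  classical
  refine ((f.finite_partitionIter n).image fun A =>
    if h : A.Nonempty then f.linearPartIter n h.some else 0).subset ?_
  rintro _ ⟨x, hx, rfl⟩
  have hne : {y | f.SameItinerary n x y}.Nonempty := ⟨x, .refl_of_mem hx⟩
  refine ⟨_, f.setOf_sameItinerary_mem_partitionIter hx, ?_⟩
  dsimp only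
  rw [dif_pos hne]
  exact (SameItinerary.linearPartIter_eq hne.some_mem).symm

/-- A set that meets at most `N` elements of `𝒵^n` splits into `N` sets of constant itinerary. -/
theorem splits_sameItinerary (f : PiecewiseAffineMap X) (n N : ℕ) {P : Set X}
    (hP : P ⊆ f.domainIter n) (hN : {A ∈ f.partitionIter n | (A ∩ P).Nonempty}.encard ≤ N) :
    Splits P N (f.SameItinerary n) := by
  have hfin : {A ∈ f.partitionIter n | (A ∩ P).Nonempty}.Finite :=
    (f.finite_partitionIter n).subset (sep_subset _ _)
  refine (Splits.of_finset hfin.toFinset (fun x => {y | f.SameItinerary n x y})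
    (fun x hx => ?_) fun x hx y hy h => ?_).mono_card ?_
  · rw [Set.Finite.mem_toFinset]
    exact ⟨f.setOf_sameItinerary_mem_partitionIter (hP hx), x, .refl_of_mem (hP hx), hx⟩
  · have : y ∈ {z | f.SameItinerary n x z} := by
      rw [h]
      exact .refl_of_mem (hP hy)
    exact this
  · rw [hfin.encard_eq_coe_toFinset_card] at hN
    exact_mod_cast hN

/-- Take a Lebesgue number of the open cover by the sets `c a`, which remove from `X` the closures
of all partition elements not adherent to `a`. A set inside `c a` meets only elements whose closure
contains `a`. -/
theorem exists_pos_encard_le_mult [CompactSpace X] (f : PiecewiseAffineMap X) (n : ℕ) :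
    ∃ δ > 0, ∀ P : Set X, (∀ x ∈ P, ∀ y ∈ P, dist x y < δ) →
      {A ∈ f.partitionIter n | (A ∩ P).Nonempty}.encard ≤ f.mult n := by
  set c : X → Set X := fun a => (⋃ A ∈ {A ∈ f.partitionIter n | a ∉ closure A}, closure A)ᶜ with hc
  have hopen : ∀ a, IsOpen (c a) := fun a => isOpen_compl_iff.2 <|
    ((f.finite_partitionIter n).subset (sep_subset _ _)).isClosed_biUnion
      fun _ _ => isClosed_closure
  obtain ⟨δ, hδ, h⟩ := lebesgue_number_lemma_of_metric isCompact_univ hopen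
    (fun a _ => mem_iUnion.2 ⟨a, by simp [hc]⟩)
  refine ⟨δ, hδ, fun P hP => ?_⟩
  rcases P.eq_empty_or_nonempty with rfl | ⟨p, hp⟩
  · simp
  obtain ⟨a, ha⟩ := h p (mem_univ p)
  refine le_trans (encard_le_encard ?_)
    (le_iSup (fun a => {A ∈ f.partitionIter n | a ∈ closure A}.encard) a)
  rintro A ⟨hA, x, hxA, hxP⟩
  refine ⟨hA, by_contra fun haA => ?_⟩
  exact ha (Metric.mem_ball.2 (hP x hxP p hp)) (mem_biUnion ⟨hA, haA⟩ (subset_closure hxA))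

theorem splits_dist_le [CompactSpace X] {r : ℝ} (hr : 0 < r) :
    ∃ N : ℕ, Splits (univ : Set X) N fun x y => dist x y ≤ r := by
  obtain ⟨t, -, ht, hcov⟩ := Metric.totallyBounded_iff.1
    (isCompact_univ (X := X)).totallyBounded (r / 2) (half_pos hr) |>.imp fun t h =>
      (⟨subset_univ t, h⟩ : t ⊆ univ ∧ _)
  have : ∀ x : X, ∃ y ∈ t, dist x y < r / 2 := fun x => by
    simpa using hcov (mem_univ x)
  choose g hg hgx using this
  refine ⟨_, Splits.of_finset ht.toFinset g (fun x _ => by simpa using hg x)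
    fun x _ y _ h => ?_⟩
  have h2 := hgx y
  rw [← h] at h2
  linarith [dist_triangle_right x y (g x), hgx x]

/-! ### Blocks of length `T` and the bound on cover numbers. -/

/-- The block estimate: a small set of points splits, after `T` iterations, into few sets that are
as small as the initial one. -/
theorem splits_block (f : PiecewiseAffineMap X) (T M : ℕ) {r L : ℝ} (hr : 0 < r)
    (hL : ∀ x ∈ f.domainIter T, ∀ k : Fin (d + 1), extPowerNorm k (f.linearPartIter T x) ≤ L)
    {P : Set X} (hP : P ⊆ f.domainIter T) (hPr : ∀ x ∈ P, ∀ y ∈ P, dist x y ≤ r)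
    (hM : {A ∈ f.partitionIter T | (A ∩ P).Nonempty}.encard ≤ M) :
    Splits P (M * ⌊(2 * d + 5 : ℝ) ^ d * L⌋₊) fun x y =>
      f.SameItinerary T x y ∧ dist (f.toFun^[T] x) (f.toFun^[T] y) ≤ r := by
  refine (f.splits_sameItinerary T M hP hM).refine fun Q hQ hQi => ?_
  rcases Q.eq_empty_or_nonempty with rfl | ⟨q, hq⟩
  · exact ⟨fun _ => 0, by simp, by simp⟩
  -- All points of `Q` share an itinerary, so the linear part at `q` serves for all of them.
  have h := splits_of_dist_le (f.linearPartIter T q) hr (hL q (hP (hQ hq)))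
    (P := Subtype.val '' Q) (by
      rintro _ ⟨x, hx, rfl⟩ _ ⟨y, hy, rfl⟩
      exact hPr x (hQ hx) y (hQ hy))
  refine h.of_image.mono subset_rfl fun x hx y hy hxy => ?_
  rwa [(hQi q hq x hx).linearPartIter_eq, ← (hQi x hx y hy).iterate_sub, ← dist_eq_norm] at hxy

/-- The closeness `≤ r` at time `m * T` is carried along because it lets the next block start. -/
theorem splits_blocks (f : PiecewiseAffineMap X) (T K N : ℕ) {r δ : ℝ}
    (hN : Splits (univ : Set X) N fun x y => dist x y ≤ r)
    (hδ : ∀ x y, dist x y ≤ r → f.SameItinerary T x y →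
      ∀ k < T, dist (f.toFun^[k] x) (f.toFun^[k] y) < δ)
    (hK : ∀ P ⊆ f.domainIter T, (∀ x ∈ P, ∀ y ∈ P, dist x y ≤ r) →
      Splits P K fun x y => f.SameItinerary T x y ∧ dist (f.toFun^[T] x) (f.toFun^[T] y) ≤ r)
    (m : ℕ) :
    Splits (f.domainIter (m * T)) (N * K ^ m) fun x y =>
      (∀ k < m * T, dist (f.toFun^[k] x) (f.toFun^[k] y) < δ) ∧
        dist (f.toFun^[m * T] x) (f.toFun^[m * T] y) ≤ r := by
  induction m with
  | zero =>
    simpa using hN.mono (subset_univ _) fun x _ y _ h => h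
  | succ m ih =>
    have hsub : f.domainIter ((m + 1) * T) ⊆ f.domainIter (m * T) :=
      fun x => f.mem_domainIter_of_le (Nat.mul_le_mul_right T m.le_succ)
    rw [pow_succ, ← mul_assoc]
    refine ((ih.mono hsub fun x _ y _ h => h).refine
      (R' := fun x y => f.SameItinerary T (f.toFun^[m * T] x) (f.toFun^[m * T] y) ∧
        dist (f.toFun^[T] (f.toFun^[m * T] x)) (f.toFun^[T] (f.toFun^[m * T] y)) ≤ r)
      fun P hP hPR => ?_).mono subset_rfl ?_
    · refine (hK (f.toFun^[m * T] '' P) ?_ ?_).of_image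
      · rintro _ ⟨x, hx, rfl⟩
        exact f.iterate_mem_domainIter (by simpa [add_mul] using hP hx)
      · rintro _ ⟨x, hx, rfl⟩ _ ⟨y, hy, rfl⟩
        exact (hPR x hx y hy).2
    · rintro x - y - ⟨⟨h1, h2⟩, h3, h4⟩
      rw [show (m + 1) * T = T + m * T by ring, Function.iterate_add_apply,
        Function.iterate_add_apply]
      refine ⟨fun k hk => ?_, h4⟩
      rcases lt_or_ge k (m * T) with hkm | hkm
      · exact h1 k hkm
      · have := hδ _ _ h2 h3 (k - m * T) (by omega)
        rwa [← Function.iterate_add_apply, ← Function.iterate_add_apply,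
          Nat.sub_add_cancel hkm] at this

/-- The identity from the Euclidean metric to `ρ` is continuous on a compact space, hence uniformly
continuous. The generic `key` keeps the two metric structures on `X` apart. -/
theorem dist_lt_of_metricSpace [CompactSpace X] (ρ : MetricSpace X)
    (hρ : ρ.toPseudoMetricSpace.toUniformSpace.toTopologicalSpace =
      (instTopologicalSpaceSubtype : TopologicalSpace X)) {ε : ℝ} (hε : 0 < ε) :
    ∃ δ > 0, ∀ x y : X, dist x y < δ → ρ.dist x y < ε := by
  have key : ∀ {α β : Type} [MetricSpace α] [CompactSpace α] [MetricSpace β] (g : α → β),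
      Continuous g → ∃ δ > 0, ∀ x y, dist x y < δ → dist (g x) (g y) < ε := by
    intro α β _ _ _ g hg
    obtain ⟨δ, hδ, h⟩ := Metric.uniformContinuous_iff.1
      (CompactSpace.uniformContinuous_of_continuous hg) ε hε
    exact ⟨δ, hδ, fun x y => @h x y⟩
  exact @key X X Subtype.metricSpace inferInstance ρ id (continuous_id_iff_le.2 hρ.ge)

theorem dynDist_lt (f : PiecewiseAffineMap X) (ρ : MetricSpace X) {ε : ℝ} (hε : 0 < ε) {n : ℕ}
    {x y : X} (h : ∀ k < n, ρ.dist (f.toFun^[k] x) (f.toFun^[k] y) < ε) :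
    f.dynDist ρ n x y < ε := by
  rw [dynDist]
  rcases n.eq_zero_or_pos with rfl | hn
  · simpa using hε
  · have : Nonempty (Fin n) := ⟨⟨0, hn⟩⟩
    obtain ⟨k, hk⟩ := exists_eq_ciSup_of_finite (f := fun k : Fin n =>
      ρ.dist (f.toFun^[k] x) (f.toFun^[k] y))
    rw [← hk]
    exact h k k.2

theorem coverNumber_le (f : PiecewiseAffineMap X) (ρ : MetricSpace X) {ε : ℝ} (hε : 0 < ε)
    {n N : ℕ} (h : Splits (f.domainIter n) N fun x y =>
      ∀ k < n, ρ.dist (f.toFun^[k] x) (f.toFun^[k] y) < ε) :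
    f.coverNumber ρ ε n ≤ N := by
  obtain ⟨C, hC, hcard, hcov⟩ := h.exists_centres
  refine iInf_le_of_le C (iInf_le_of_le hC (iInf_le_of_le (fun x hx => ?_) hcard))
  obtain ⟨c, hc, h⟩ := hcov x hx
  exact ⟨c, hc, f.dynDist_lt ρ hε h⟩

theorem coverNumber_eq_zero (f : PiecewiseAffineMap X) (ρ : MetricSpace X) (ε : ℝ) {n : ℕ}
    (h : f.domainIter n = ∅) : f.coverNumber ρ ε n = 0 := by
  refine le_antisymm (iInf_le_of_le ∅ (iInf_le_of_le (empty_subset _)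
    (iInf_le_of_le (fun x hx => ?_) (by simp)))) bot_le
  simp [h] at hx

/-- The cover numbers grow at most like `(C mult(𝒵^T) L)^{n / T}`. -/
theorem exists_coverNumber_le [CompactSpace X] (f : PiecewiseAffineMap X) (ρ : MetricSpace X)
    (hρ : ρ.toPseudoMetricSpace.toUniformSpace.toTopologicalSpace =
      (instTopologicalSpaceSubtype : TopologicalSpace X)) {ε : ℝ} (hε : 0 < ε) {T : ℕ}
    (hT : 0 < T) {L : ℝ}
    (hL : ∀ x ∈ f.domainIter T, ∀ k : Fin (d + 1), extPowerNorm k (f.linearPartIter T x) ≤ L) :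
    ∃ B : ℕ, ∀ n, f.coverNumber ρ ε n ≤
      (B * ((f.mult T).toNat * ⌊(2 * d + 5 : ℝ) ^ d * L⌋₊) ^ (n / T) : ℕ) := by
  obtain ⟨δ, hδ, hδε⟩ := dist_lt_of_metricSpace ρ hρ hε
  obtain ⟨η, hη, hmult⟩ := f.exists_pos_encard_le_mult T
  obtain ⟨Λ, hΛ, hLip⟩ := f.exists_lipschitz
  have hΛT : 0 < Λ ^ T := by positivity
  -- The first bound controls the intermediate times of a block through the Lipschitz constant `Λ`,
  -- the second keeps `r` below the Lebesgue number `η`.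
  set r := min (δ / (2 * Λ ^ T)) (η / 2) with hr_def
  have hr : 0 < r := by positivity
  have hrδ : Λ ^ T * r < δ := by
    calc Λ ^ T * r ≤ Λ ^ T * (δ / (2 * Λ ^ T)) := by gcongr; exact min_le_left _ _
      _ = δ / 2 := by field_simp
      _ < δ := half_lt_self hδ
  have hrη : r < η := (min_le_right _ _).trans_lt (half_lt_self hη)
  obtain ⟨N, hN⟩ := splits_dist_le (X := X) hr
  set K := (f.mult T).toNat * ⌊(2 * d + 5 : ℝ) ^ d * L⌋₊ with hK
  have hclose : ∀ s ≤ T, ∀ x y, dist x y ≤ r → f.SameItinerary s x y →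
      ∀ k < s, dist (f.toFun^[k] x) (f.toFun^[k] y) < δ := fun s hs x y hxy h k hk =>
    calc dist (f.toFun^[k] x) (f.toFun^[k] y)
        ≤ Λ ^ s * dist x y := h.dist_le_of_le hΛ hLip hk.le
      _ ≤ Λ ^ T * r := by gcongr
      _ < δ := hrδ
  have hblocks := f.splits_blocks T K N hN (hclose T le_rfl) fun P hP hPr =>
    f.splits_block T (f.mult T).toNat hr hL hP hPr <| by
      rw [ENat.natCast_toNat (f.mult_lt_top T).ne]
      exact hmult P fun x hx y hy => (hPr x hx y hy).trans_lt hrη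
  -- For the incomplete last block, of length `n % T`, constant itinerary suffices. Summing over all
  -- lengths below `T` makes the bound independent of `n`.
  set W := ∑ s ∈ Finset.range T, (f.finite_partitionIter s).toFinset.card with hW
  refine ⟨N * W, fun n => ?_⟩
  have hs : n % T < T := Nat.mod_lt n hT
  have hn : n / T * T + n % T = n := Nat.div_add_mod' n T
  set m := n / T
  set s := n % T
  have hsplit := ((hblocks m).mono (P := f.domainIter n)
    (fun x => f.mem_domainIter_of_le (by omega)) fun x _ y _ h => h).refine
    (R' := fun x y => f.SameItinerary s (f.toFun^[m * T] x) (f.toFun^[m * T] y)) (K := W)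
    fun P hP _ => (f.splits_sameItinerary s W (P := f.toFun^[m * T] '' P) (by
      rintro _ ⟨x, hx, rfl⟩
      exact f.iterate_mem_domainIter (by simpa [hn] using hP hx)) (by
      refine (encard_le_encard (sep_subset _ _)).trans ?_
      rw [(f.finite_partitionIter s).encard_eq_coe_toFinset_card, Nat.cast_le]
      exact Finset.single_le_sum
        (f := fun s => (f.finite_partitionIter s).toFinset.card)
        (fun _ _ => Nat.zero_le _) (Finset.mem_range.2 hs))).of_image
  rw [mul_right_comm]
  refine f.coverNumber_le ρ hε (hsplit.mono subset_rfl ?_)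
  rintro x - y - ⟨⟨h1, h2⟩, h3⟩ k hk
  refine hδε _ _ ?_
  rcases lt_or_ge k (m * T) with hkm | hkm
  · exact h1 k hkm
  · have := hclose s hs.le _ _ h2 h3 (k - m * T) (by omega)
    rwa [← Function.iterate_add_apply, ← Function.iterate_add_apply,
      Nat.sub_add_cancel hkm] at this

end PiecewiseAffineMap

/-! ### Growth rates in `EReal` and the limit `T → ∞`. -/

namespace PiecewiseAffineMap

variable {d : ℕ} {X : Set (Euc d)}

theorem entropyAt_eq_bot (f : PiecewiseAffineMap X) (ρ : MetricSpace X) (ε : ℝ) {T : ℕ}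
    (h : f.domainIter T = ∅) : f.entropyAt ρ ε = ⊥ := by
  have : (fun n : ℕ => ENNReal.log (f.coverNumber ρ ε n : ℝ≥0∞) / (n : EReal))
      =ᶠ[atTop] fun _ => ⊥ := by
    -- `n = 0` is excluded because `⊥ / 0 = 0` in `EReal`.
    filter_upwards [eventually_ge_atTop T, eventually_gt_atTop 0] with n hn hn0
    have hempty : f.domainIter n = ∅ :=
      subset_empty_iff.1 (h ▸ fun x => f.mem_domainIter_of_le hn)
    rw [f.coverNumber_eq_zero ρ ε hempty, ENat.toENNReal_zero, ENNReal.log_zero]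
    exact EReal.bot_div_of_pos_ne_top (by exact_mod_cast hn0) (EReal.natCast_ne_top n)
  rw [entropyAt, limsup_congr this, limsup_const]

/-- Exponential growth rate of a sequence that is at most `B * K ^ (n / T)`. -/
theorem entropyAt_le_log_div (f : PiecewiseAffineMap X) (ρ : MetricSpace X) {ε : ℝ} {T B K : ℕ}
    (hT : 0 < T) (hK : 1 ≤ K) (h : ∀ n, f.coverNumber ρ ε n ≤ (B * K ^ (n / T) : ℕ)) :
    f.entropyAt ρ ε ≤ ((Real.log K / T : ℝ) : EReal) := by
  have hlim : Tendsto (fun n : ℕ => ((Real.log (B + 1) / n + Real.log K / T : ℝ) : EReal)) atTop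
      (𝓝 ((Real.log K / T : ℝ) : EReal)) := by
    refine (continuous_coe_real_ereal.tendsto _).comp ?_
    simpa using (tendsto_const_div_atTop_nhds_zero_nat (Real.log (B + 1))).add_const
      (Real.log K / T)
  rw [← hlim.limsup_eq]
  refine limsup_le_limsup ?_
  filter_upwards [eventually_gt_atTop 0] with n hn
  have hn' : (0 : ℝ) < n := by exact_mod_cast hn
  have hT' : (0 : ℝ) < T := by exact_mod_cast hT
  have hK' : (1 : ℝ) ≤ K := by exact_mod_cast hK
  -- `B + 1` replaces `B`, which may be `0`, before taking logarithms.
  have hcov : (f.coverNumber ρ ε n : ℝ≥0∞) ≤ ENNReal.ofReal ((B + 1) * (K : ℝ) ^ (n / T)) := by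
    refine (ENat.toENNReal_le.2 ((h n).trans (b := _)
      (c := (((B + 1) * K ^ (n / T) : ℕ) : ℕ∞)) ?_)).trans_eq ?_
    · exact_mod_cast Nat.mul_le_mul_right _ B.le_succ
    · rw [ENat.toENNReal_coe, ← ENNReal.ofReal_natCast]
      push_cast
      rfl
  refine (EReal.div_le_div_right_of_nonneg (by positivity) (ENNReal.log_monotone hcov)).trans ?_
  rw [ENNReal.log_ofReal_of_pos (by positivity)]
  change ((Real.log ((B + 1) * (K : ℝ) ^ (n / T)) / n : ℝ) : EReal) ≤ _
  rw [EReal.coe_le_coe_iff, Real.log_mul (by positivity) (by positivity), Real.log_pow, add_div]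
  refine add_le_add_right ?_ _
  rw [div_le_div_iff₀ hn' hT']
  have h1 : ((n / T : ℕ) : ℝ) * T ≤ n := by exact_mod_cast Nat.div_mul_le_self n T
  nlinarith [Real.log_nonneg hK']

/-- The empty wedge is a unit vector fixed by `Λ^0 A`. -/
theorem one_le_extPowerNorm_zero (A : Euc d →ₗ[ℝ] Euc d) : 1 ≤ extPowerNorm 0 A := by
  set v := exteriorPower.ιMulti ℝ 0 (Fin.elim0 : Fin 0 → Euc d)
  have hv : ‖v‖ = 1 := by
    rw [← sq_eq_sq₀ (norm_nonneg _) zero_le_one, ← real_inner_self_eq_norm_sq,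
      exteriorPower.inner_ιMulti_self, Matrix.det_fin_zero, one_pow]
  have := (exteriorPower.map 0 A).toContinuousLinearMap.le_opNorm v
  rw [LinearMap.coe_toContinuousLinearMap', exteriorPower.map_apply_ιMulti,
    Subsingleton.elim (A ∘ Fin.elim0) Fin.elim0] at this
  change ‖v‖ ≤ extPowerNorm 0 A * ‖v‖ at this
  rwa [hv, mul_one] at this

theorem one_le_mult (f : PiecewiseAffineMap X) {n : ℕ} {x : X} (hx : x ∈ f.domainIter n) :
    1 ≤ f.mult n := by
  refine le_trans ?_ (le_iSup (fun a => {A ∈ f.partitionIter n | a ∈ closure A}.encard) x)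
  rw [one_le_encard_iff_nonempty]
  exact ⟨_, f.setOf_sameItinerary_mem_partitionIter hx,
    subset_closure (SameItinerary.refl_of_mem hx)⟩

/-- The largest of the finitely many numbers `‖Λ^k d_x f^n‖` is attained. -/
theorem exists_extPowerNorm_max (f : PiecewiseAffineMap X) {n : ℕ}
    (hne : (f.domainIter n).Nonempty) :
    ∃ x ∈ f.domainIter n, ∃ k : Fin (d + 1), ∀ y ∈ f.domainIter n, ∀ l : Fin (d + 1),
      extPowerNorm l (f.linearPartIter n y) ≤ extPowerNorm k (f.linearPartIter n x) := by
  obtain ⟨⟨_, k⟩, ⟨⟨x, hx, rfl⟩, -⟩, h⟩ := Set.exists_max_image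
    ((f.linearPartIter n '' f.domainIter n) ×ˢ (univ : Set (Fin (d + 1))))
    (fun p => extPowerNorm p.2 p.1) ((f.finite_image_linearPartIter n).prod finite_univ)
    ((hne.image _).prod univ_nonempty)
  exact ⟨x, hx, k, fun y hy l => h (_, l) ⟨mem_image_of_mem _ hy, mem_univ l⟩⟩

theorem entropyAt_le_add [CompactSpace X] (f : PiecewiseAffineMap X) (ρ : MetricSpace X)
    (hρ : ρ.toPseudoMetricSpace.toUniformSpace.toTopologicalSpace =
      (instTopologicalSpaceSubtype : TopologicalSpace X)) {ε : ℝ} (hε : 0 < ε) {T : ℕ}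
    (hT : 0 < T) (hne : (f.domainIter T).Nonempty) :
    f.entropyAt ρ ε ≤ ((Real.log ((2 * d + 5) ^ d) / T : ℝ) : EReal) +
      ((⨆ x ∈ f.domainIter T, (⨆ k : Fin (d + 1),
        ENNReal.log (ENNReal.ofReal (extPowerNorm k (f.linearPartIter T x)))) / (T : EReal)) +
      ENNReal.log (f.mult T : ℝ≥0∞) / (T : EReal)) := by
  obtain ⟨x, hx, k, hmax⟩ := f.exists_extPowerNorm_max hne
  set L := extPowerNorm k (f.linearPartIter T x) with hLdef
  obtain ⟨B, hB⟩ := f.exists_coverNumber_le ρ hρ hε hT (L := L) hmax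
  have hL : 1 ≤ L := (one_le_extPowerNorm_zero _).trans (hmax x hx 0)
  have hC : (1 : ℝ) ≤ (2 * d + 5) ^ d := one_le_pow₀ (by
    linarith [(Nat.cast_nonneg d : (0 : ℝ) ≤ d)])
  obtain ⟨M, hM⟩ := ENat.ne_top_iff_exists.1 (f.mult_lt_top T).ne
  have hM1 : 1 ≤ M := by
    have := f.one_le_mult hx
    rw [← hM] at this
    exact_mod_cast this
  rw [← hM, ENat.toNat_natCast] at hB
  set N := ⌊(2 * d + 5 : ℝ) ^ d * L⌋₊
  have hN : 1 ≤ N := Nat.le_floor (by push_cast; nlinarith)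
  have hNle : (N : ℝ) ≤ (2 * d + 5) ^ d * L := Nat.floor_le (by positivity)
  have hM' : (1 : ℝ) ≤ M := by exact_mod_cast hM1
  have hN' : (1 : ℝ) ≤ N := by exact_mod_cast hN
  refine (f.entropyAt_le_log_div ρ hT (Nat.mul_pos hM1 hN) hB).trans ?_
  have hlog : Real.log ((M * N : ℕ) : ℝ) / T ≤
      Real.log ((2 * d + 5) ^ d) / T + (Real.log L / T + Real.log M / T) := by
    rw [← add_div, ← add_div]
    gcongr
    push_cast
    rw [Real.log_mul (by positivity) (by positivity)]
    have := Real.log_le_log (by positivity) hNle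
    rw [Real.log_mul (by positivity) (by positivity)] at this
    linarith
  refine (EReal.coe_le_coe_iff.2 hlog).trans ?_
  rw [EReal.coe_add, EReal.coe_add]
  gcongr
  · refine le_trans ?_ (le_iSup₂ (f := fun x _ => (⨆ k : Fin (d + 1), ENNReal.log
      (ENNReal.ofReal (extPowerNorm k (f.linearPartIter T x)))) / (T : EReal)) x hx)
    change (Real.log L : EReal) / (T : EReal) ≤ _
    refine EReal.div_le_div_right_of_nonneg (by positivity) ?_
    rw [← ENNReal.log_ofReal_of_pos (by positivity)]
    exact le_iSup (fun k : Fin (d + 1) => ENNReal.log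
      (ENNReal.ofReal (extPowerNorm k (f.linearPartIter T x)))) k
  · rw [← hM, ENat.toENNReal_coe, ← ENNReal.ofReal_natCast,
      ENNReal.log_ofReal_of_pos (by positivity)]
    rfl

theorem expansionRate_nonneg (f : PiecewiseAffineMap X)
    (hne : ∀ n, (f.domainIter n).Nonempty) : 0 ≤ f.expansionRate := by
  refine le_limsup_of_frequently_le (Eventually.frequently (Eventually.of_forall fun n => ?_))
  obtain ⟨x, hx⟩ := hne n
  refine le_iSup₂_of_le x hx (EReal.div_nonneg ?_ (by positivity))
  refine le_iSup_of_le 0 (ENNReal.zero_le_log_iff.2 ?_)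
  exact ENNReal.one_le_ofReal.2 (one_le_extPowerNorm_zero _)

theorem multEntropy_nonneg (f : PiecewiseAffineMap X)
    (hne : ∀ n, (f.domainIter n).Nonempty) : 0 ≤ f.multEntropy := by
  refine le_limsup_of_frequently_le (Eventually.frequently (Eventually.of_forall fun n => ?_))
  obtain ⟨x, hx⟩ := hne n
  refine EReal.div_nonneg (ENNReal.zero_le_log_iff.2 ?_) (by positivity)
  rw [← ENat.toENNReal_one]
  exact ENat.toENNReal_le.2 (f.one_le_mult hx)

end PiecewiseAffineMap

theorem theorem1 {d : ℕ} {X : Set (Euc d)} (hX : IsCompact X) (f : PiecewiseAffineMap X)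
    (ρ : MetricSpace X)
    (hρ : ρ.toPseudoMetricSpace.toUniformSpace.toTopologicalSpace =
      (instTopologicalSpaceSubtype : TopologicalSpace X)) :
    f.entropy ρ ≤ f.expansionRate + f.multEntropy := by
  have : CompactSpace X := isCompact_iff_compactSpace.1 hX
  refine iSup₂_le fun ε hε => ?_
  by_cases hne : ∀ n, (f.domainIter n).Nonempty
  · have hlim : Tendsto (fun T : ℕ => ((Real.log ((2 * d + 5) ^ d) / T : ℝ) : EReal)) atTop
        (𝓝 0) :=
      (continuous_coe_real_ereal.tendsto 0).comp (tendsto_const_div_atTop_nhds_zero_nat _)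
    have hex := f.expansionRate_nonneg hne
    have hmu := f.multEntropy_nonneg hne
    -- Nonnegativity of both rates rules out `⊥ + ⊤`, for which subadditivity of `limsup` could
    -- fail.
    have hbot : ∀ {a : EReal}, 0 ≤ a → a ≠ ⊥ := fun h => (EReal.bot_lt_zero.trans_le h).ne'
    have hadd : _ ≤ f.expansionRate + f.multEntropy :=
      EReal.limsup_add_le (.inl (hbot hex)) (.inr (hbot hmu))
    refine le_trans ?_ hadd
    rw [← zero_add (limsup _ _), ← hlim.limsup_eq]
    refine le_trans ?_ (EReal.limsup_add_le (.inl (by rw [hlim.limsup_eq]; exact EReal.zero_ne_bot))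
      (.inl (by rw [hlim.limsup_eq]; exact EReal.zero_ne_top)))
    -- The left side does not depend on `T`, so the estimates for `T > 0` bound it by the `limsup`.
    refine le_limsup_of_frequently_le (Eventually.frequently ?_)
    filter_upwards [eventually_gt_atTop 0] with T hT
    exact f.entropyAt_le_add ρ hρ hε hT (hne T)
  · obtain ⟨T, hT⟩ := not_forall.1 hne
    rw [f.entropyAt_eq_bot ρ ε (not_nonempty_iff_eq_empty.1 hT)]
    exact bot_le
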